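/- Let $n\ge 1$, $d=2^n$, and consider $n$ qubits on an open chain. Let $\mathbb{SP}(d/2)=\{U\in\mathbb U(d): U^{\mathsf T}\Omega U=\Omega\}$ with $\Omega=iY_1$ ($iY$ on the first qubit, identity elsewhere). A $2$-local symplectic gate is an element of $\mathbb{SP}(d/2)$ acting non-trivially on at most one site or one pair of neighbouring sites; a layer is a product of such gates on pairwise disjoint sets of sites, and a depth-$L$ circuit is a product of $L$ layers. For a probability measure $\mathcal E$ on $\mathbb{SP}(d/2)$ let $\phi^{(2)}_{\mathcal E}(X)=\mathbb E_{U\sim\mathcal E}[U^{\otimes 2}X(U^\dagger)^{\otimes 2}]$, let $\phi^{(2)}_{\mathbb{SP}(d/2)}$ be the same for the Haar probability measure, and let $\|\phi-\phi'\|_\diamond=\sup_\rho\|((\phi-\phi')\otimes \mathrm{id}_{\rm anc})\rho\|_1$ over all states $\rho$ with an ancilla of arbitrary finite dimension. $\mathcal E$ is an (additive) $\varepsilon$-approximate symplectic $2$-design if $\|\phi^{(2)}_{\mathcal E}-\phi^{(2)}_{\mathbb{SP}(d/2)}\|_\diamond\le\varepsilon$. Let $\mathcal E_L$ be any ensemble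 (Borel probability measure on $\mathbb{SP}(d/2)$) of depth-$L$ circuits of $2$-local symplectic gates, $L\ge 0$. If $S$ is any set of qubits such that $UZ_1U^\dagger$ is supported on $S$ for (almost) all $U\sim\mathcal E_L$, and $d_L=2^{|S|}$, then $$\big\|\phi^{(2)}_{\mathcal E_L}-\phi^{(2)}_{\mathbb{SP}(d/2)}\big\|_\diamond\ \ge\ 2\left(1-\frac{d_L^2+d_L}{d(d+1)}\right).$$ The first $\min(L+1,n)$ qubits always form such a set, so the bound holds with $d_L=2^{\min(L+1,n)}$. Consequently any such ensemble needs depth $L\ge n-1$ to form an approximate symplectic $2$-design: if $\mathcal E_L$ is an $\varepsilon$-approximate symplectic $2$-design with $\varepsilon<\frac32-\frac1{2(d+1)}$, then $L\ge n-1$. -/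

import Mathlib

open MeasureTheory Matrix
open scoped ENNReal ComplexOrder

noncomputable section

/-- Labels of the computational basis of `n` qubits; `ℋ = (ℂ²)^{⊗n}` has dimension `2 ^ n`. -/
abbrev QBasis (n : ℕ) : Type := Fin n → Fin 2

/-- Linear operators on `n` qubits, as matrices in the computational basis. -/
abbrev QOp (n : ℕ) : Type := Matrix (QBasis n) (QBasis n) ℂ

/-- The operator acting as the `2 × 2` matrix `A` on qubit `j` and as the identity elsewhere. -/
def onQubit {n : ℕ} (j : Fin n) (A : Matrix (Fin 2) (Fin 2) ℂ) : QOp n :=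
  Matrix.of fun x y => if ∀ i, i ≠ j → x i = y i then A (x j) (y j) else 0

/-- The Pauli matrix `Y`. -/
def pauliY : Matrix (Fin 2) (Fin 2) ℂ := !![0, -Complex.I; Complex.I, 0]

/-- The Pauli matrix `Z`. -/
def pauliZ : Matrix (Fin 2) (Fin 2) ℂ := !![1, 0; 0, -1]

/-- The operator `A` acts as the identity on all qubits outside `S`: `A = B ⊗ 𝟙` for some
operator `B` on the qubits in `S`. -/
def SupportedOn {n : ℕ} (S : Finset (Fin n)) (A : QOp n) : Prop :=
  ∃ B : Matrix (S → Fin 2) (S → Fin 2) ℂ, ∀ x y : QBasis n,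
    A x y = if ∀ i, i ∉ S → x i = y i then B (fun i => x i) (fun i => y i) else 0

/-- The antisymmetric form `Ω = iY` on the first qubit, tensored with the identity. -/
def sympForm (n : ℕ) [NeZero n] : QOp n := onQubit 0 (Complex.I • pauliY)

/-- The unitary symplectic group `{U ∈ 𝕌(d) : Uᵀ Ω U = Ω}`, `d = 2 ^ n`. -/
def SP (n : ℕ) [NeZero n] : Subgroup (Matrix.unitaryGroup (QBasis n) ℂ) where
  carrier := {U | (U : QOp n)ᵀ * sympForm n * (U : QOp n) = sympForm n}
  one_mem' := by simp
  mul_mem' := by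
    intro a b ha hb
    simp only [Set.mem_ofPred_eq, Submonoid.coe_mul, Matrix.transpose_mul] at *
    calc _ = (b : QOp n)ᵀ * ((a : QOp n)ᵀ * sympForm n * (a : QOp n)) * (b : QOp n) := by
          simp only [Matrix.mul_assoc]
      _ = _ := by rw [ha, hb]
  inv_mem' := by
    intro a ha
    simp only [Set.mem_ofPred_eq] at *
    have h1 : (a : QOp n) * ((a⁻¹ : Matrix.unitaryGroup (QBasis n) ℂ) : QOp n) = 1 := by
      rw [← Submonoid.coe_mul, mul_inv_cancel, Submonoid.coe_one]
    have h2 : ((a⁻¹ : Matrix.unitaryGroup (QBasis n) ℂ) : QOp n)ᵀ * (a : QOp n)ᵀ = 1 := by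
      rw [← Matrix.transpose_mul, h1, Matrix.transpose_one]
    conv_lhs => rw [← ha]
    calc _ = (((a⁻¹ : Matrix.unitaryGroup (QBasis n) ℂ) : QOp n)ᵀ * (a : QOp n)ᵀ) * sympForm n *
            ((a : QOp n) * ((a⁻¹ : Matrix.unitaryGroup (QBasis n) ℂ) : QOp n)) := by
          simp only [Matrix.mul_assoc]
      _ = _ := by rw [h1, h2, Matrix.one_mul, Matrix.mul_one]

/-- The underlying operator of an element of the group. -/
def toOp {n : ℕ} [NeZero n] (U : SP n) : QOp n := ((U : Matrix.unitaryGroup (QBasis n) ℂ) : QOp n)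

instance SP.instMeasurableSpace (n : ℕ) [NeZero n] : MeasurableSpace (SP n) := borel _

instance SP.instBorelSpace (n : ℕ) [NeZero n] : BorelSpace (SP n) := ⟨rfl⟩

instance SP.instCompactSpace (n : ℕ) [NeZero n] : CompactSpace (SP n) := by
  let K : Set (QOp n) := {A | A ∈ Matrix.unitaryGroup (QBasis n) ℂ ∧
    Aᵀ * sympForm n * A = sympForm n}
  have hclosed : IsClosed K := by
    have : K = {A : QOp n | star A * A = 1} ∩ {A : QOp n | Aᵀ * sympForm n * A = sympForm n} := by
      ext A
      simp [K, Matrix.mem_unitaryGroup_iff']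
    rw [this]
    refine (isClosed_eq ?_ continuous_const).inter (isClosed_eq ?_ continuous_const)
    · exact continuous_star.mul continuous_id
    · exact (continuous_id.matrix_transpose.mul continuous_const).mul continuous_id
  have hK : IsCompact K := by
    refine IsCompact.of_isClosed_subset (s := Set.univ.pi fun _ => Set.univ.pi fun _ =>
      Metric.closedBall (0 : ℂ) 1) ?_ hclosed ?_
    · exact isCompact_univ_pi fun _ => isCompact_univ_pi fun _ => isCompact_closedBall _ _
    · intro A hA
      simp only [Set.mem_pi, Set.mem_univ, true_imp_iff, mem_closedBall_zero_iff]
      exact fun i j => entry_norm_bound_of_unitary hA.1 i j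
  have hind : Topology.IsInducing (toOp : SP n → QOp n) :=
    Topology.IsInducing.subtypeVal.comp Topology.IsInducing.subtypeVal
  have hrange : Set.range (toOp : SP n → QOp n) = K := by
    ext A
    constructor
    · rintro ⟨U, rfl⟩
      exact ⟨U.1.2, U.2⟩
    · rintro ⟨h1, h2⟩
      exact ⟨⟨⟨A, h1⟩, h2⟩, rfl⟩
  exact ⟨by rw [hind.isCompact_iff, Set.image_univ, hrange]; exact hK⟩

/-- The Haar probability measure on the unitary symplectic group. -/
def haarSP (n : ℕ) [NeZero n] : Measure (SP n) := Measure.haarMeasure ⊤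

/-- The `k`-fold tensor power `U^{⊗k}`. -/
def tensorPow {ι : Type*} (k : ℕ) (U : Matrix ι ι ℂ) : Matrix (Fin k → ι) (Fin k → ι) ℂ :=
  Matrix.of fun x y => ∏ i, U (x i) (y i)

/-- The `k`-th moment channel `X ↦ 𝔼_{U ∼ E} [U^{⊗k} X (U†)^{⊗k}]` of an ensemble `E`; the
expectation is taken entrywise. -/
def momentChannel {n : ℕ} [NeZero n] (k : ℕ) (E : Measure (SP n))
    (X : Matrix (Fin k → QBasis n) (Fin k → QBasis n) ℂ) :
    Matrix (Fin k → QBasis n) (Fin k → QBasis n) ℂ :=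
  Matrix.of fun x y => ∫ U : SP n, (tensorPow k (toOp U) * X * (tensorPow k (toOp U))ᴴ) x y ∂E

/-- The map `Φ ⊗ id` on operators on the tensor product with an ancilla of dimension `m`. -/
def withAncilla {κ : Type*} (Φ : Matrix κ κ ℂ → Matrix κ κ ℂ) (m : ℕ)
    (ρ : Matrix (κ × Fin m) (κ × Fin m) ℂ) : Matrix (κ × Fin m) (κ × Fin m) ℂ :=
  Matrix.of fun x y => Φ (Matrix.of fun i j => ρ (i, x.2) (j, y.2)) x.1 y.1

/-- The trace norm: the sum of the singular values. -/
def traceNorm {κ : Type*} [Fintype κ] [DecidableEq κ] (A : Matrix κ κ ℂ) : ℝ :=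
  ∑ i, √((Matrix.isHermitian_conjTranspose_mul_self A).eigenvalues i)

/-- Quantum states (density matrices). -/
def IsState {κ : Type*} [Fintype κ] (ρ : Matrix κ κ ℂ) : Prop :=
  ρ.PosSemidef ∧ ρ.trace = 1

/-- The diamond distance `sup_ρ ‖((Φ - Ψ) ⊗ id_anc) ρ‖₁`, over all states `ρ` on the system
together with an ancilla of arbitrary finite dimension. -/
def diamondDist {κ : Type*} [Fintype κ] [DecidableEq κ]
    (Φ Ψ : Matrix κ κ ℂ → Matrix κ κ ℂ) : ℝ≥0∞ :=
  ⨆ (m : ℕ) (ρ : Matrix (κ × Fin m) (κ × Fin m) ℂ) (_ : IsState ρ),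
    ENNReal.ofReal (traceNorm (withAncilla (fun X => Φ X - Ψ X) m ρ))

/-- `E` is an additive `ε`-approximate `k`-design over the unitary symplectic group. -/
def IsApproxDesign {n : ℕ} [NeZero n] (k : ℕ) (ε : ℝ) (E : Measure (SP n)) : Prop :=
  diamondDist (momentChannel k E) (momentChannel k (haarSP n)) ≤ ENNReal.ofReal ε

/-- A site or a bond of the chain of qubits `1 - 2 - ⋯ - n`. -/
def IsBond {n : ℕ} (s : Finset (Fin n)) : Prop :=
  ∃ i j : Fin n, (i : ℕ) ≤ j ∧ (j : ℕ) ≤ i + 1 ∧ s = {i, j}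

/-- A layer: a product of symplectic gates, each on one qubit or on two neighbouring qubits, with
pairwise disjoint sets of qubits. -/
def IsLayer {n : ℕ} [NeZero n] (W : SP n) : Prop :=
  ∃ l : List (Finset (Fin n) × SP n),
    (∀ g ∈ l, IsBond g.1 ∧ SupportedOn g.1 (toOp g.2)) ∧
    l.Pairwise (fun g h => Disjoint g.1 h.1) ∧
    W = (l.map Prod.snd).prod

/-- The circuits of depth `L` built from `2`-local symplectic gates on the chain: products of `L`
layers. -/
def circuits (n : ℕ) [NeZero n] (L : ℕ) : Set (SP n) :=
  {U | ∃ l : List (SP n), l.length = L ∧ (∀ W ∈ l, IsLayer W) ∧ U = l.prod}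

end

/-! One input state and one measurement separate the two channels. Write `|A⟩⟩` for the operator `A`
as a normalized vector of the doubled system. For symplectic `U`, `Ω Uᵀ = U† Ω`, so `U ⊗ U` sends
`|Z₁ Ω⟩⟩` to `|U Z₁ U† Ω⟩⟩`. Measuring in the orthonormal basis `|P Ω⟩⟩`, with `P` a Pauli string,
yields `P` with probability `|tr (P U Z₁ U†)|² / d²`.

If `U Z₁ U†` is supported on `S`, only strings on `S` occur. Under Haar measure, the strings with
`Pᵀ Ω = Ω P` have probability zero, because `U Z₁ U†` satisfies the opposite relation. The strings
with `Pᵀ Ω = -Ω P` are equally likely: the group permutes them transitively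
(`exists_conj_pauliString`) and Haar measure is invariant. There are `d (d + 1) / 2` of them, at
most `(d_L² + d_L) / 2` on `S` (`sum_sympSign_le`), so the Haar probability of a string on `S` is at
most `h = (d_L² + d_L) / (d (d + 1))`. The trace norm dominates the signed difference of outcome
probabilities (`sum_le_traceNorm`), hence the bound `2 (1 - h)`.

For circuits, each layer moves the edge of the light cone of the first qubit by at most one site
(`supportedOn_conj_layer`). If `L < n - 1` then `d_L ≤ d / 2`, which gives the threshold on `ε`. -/

noncomputable section

/-! ### Tensor products of one-qubit operators -/

section Tensor

variable {n : ℕ}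

/-- The tensor product of one-qubit operators. -/
def tensorOp (M : Fin n → Matrix (Fin 2) (Fin 2) ℂ) : QOp n :=
  Matrix.of fun x y => ∏ i, M i (x i) (y i)

theorem tensorOp_mul (M N : Fin n → Matrix (Fin 2) (Fin 2) ℂ) :
    tensorOp M * tensorOp N = tensorOp (fun i => M i * N i) := by
  ext x y
  simp only [tensorOp, Matrix.mul_apply, Matrix.of_apply, ← Finset.prod_mul_distrib]
  rw [Finset.prod_univ_sum]
  simp

theorem tensorOp_one : tensorOp (fun _ : Fin n => 1) = 1 := by
  ext x y
  simp only [tensorOp, Matrix.of_apply, Matrix.one_apply, Finset.prod_ite_zero]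
  simp [funext_iff]

theorem tensorOp_conjTranspose (M : Fin n → Matrix (Fin 2) (Fin 2) ℂ) :
    (tensorOp M)ᴴ = tensorOp (fun i => (M i)ᴴ) := by
  ext x y
  simp [tensorOp, Matrix.conjTranspose_apply]

theorem tensorOp_transpose (M : Fin n → Matrix (Fin 2) (Fin 2) ℂ) :
    (tensorOp M)ᵀ = tensorOp (fun i => (M i)ᵀ) := by
  ext x y
  simp [tensorOp]

theorem tensorOp_smul (c : Fin n → ℂ) (M : Fin n → Matrix (Fin 2) (Fin 2) ℂ) :
    tensorOp (fun i => c i • M i) = (∏ i, c i) • tensorOp M := by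
  ext x y
  simp [tensorOp, Finset.prod_mul_distrib]

theorem trace_tensorOp (M : Fin n → Matrix (Fin 2) (Fin 2) ℂ) :
    (tensorOp M).trace = ∏ i, (M i).trace := by
  simp only [tensorOp, Matrix.trace, Matrix.diag, Matrix.of_apply]
  rw [Finset.prod_univ_sum]
  simp

theorem onQubit_eq_tensorOp (j : Fin n) (A : Matrix (Fin 2) (Fin 2) ℂ) :
    onQubit j A = tensorOp (fun i => if i = j then A else 1) := by
  ext x y
  simp only [onQubit, tensorOp, Matrix.of_apply]
  rw [← Finset.mul_prod_erase _ _ (Finset.mem_univ j)]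
  have : ∀ i ∈ Finset.univ.erase j, (if i = j then A else 1) (x i) (y i)
      = if x i = y i then 1 else 0 := by
    intro i hi
    rw [if_neg (Finset.ne_of_mem_erase hi), Matrix.one_apply]
  rw [Finset.prod_congr rfl this, Finset.prod_ite_zero]
  simp

end Tensor

/-! ### Supports of operators -/

section Support

variable {n : ℕ} {S T : Finset (Fin n)} {A B : QOp n}

theorem supportedOn_iff : SupportedOn S A ↔
    (∀ x y, A x y ≠ 0 → ∀ i, i ∉ S → x i = y i) ∧
    (∀ x y x' y', (∀ i, i ∉ S → x i = y i) → (∀ i, i ∉ S → x' i = y' i) →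
      (∀ i ∈ S, x i = x' i) → (∀ i ∈ S, y i = y' i) → A x y = A x' y') := by
  constructor
  · rintro ⟨B, hB⟩
    refine ⟨fun x y h => ?_, fun x y x' y' h h' hx hy => ?_⟩
    · by_contra hc
      exact h (by rw [hB, if_neg hc])
    · rw [hB, hB, if_pos h, if_pos h']
      congr 1 <;> ext1 i
      · exact hx i i.2
      · exact hy i i.2
  · rintro ⟨h1, h2⟩
    refine ⟨Matrix.of fun a b => A (fun i => if h : i ∈ S then a ⟨i, h⟩ else 0)
      (fun i => if h : i ∈ S then b ⟨i, h⟩ else 0), fun x y => ?_⟩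
    split_ifs with h
    · refine h2 _ _ _ _ h ?_ ?_ ?_ <;> intro i hi <;> simp [hi]
    · by_contra hc
      exact h (h1 x y hc)

theorem SupportedOn.conjTranspose (h : SupportedOn S A) : SupportedOn S Aᴴ := by
  obtain ⟨B, hB⟩ := h
  refine ⟨Bᴴ, fun x y => ?_⟩
  simp only [Matrix.conjTranspose_apply, hB]
  simp only [eq_comm (a := y _) (b := x _)]
  split_ifs <;> simp

theorem supportedOn_onQubit (j : Fin n) (M : Matrix (Fin 2) (Fin 2) ℂ) :
    SupportedOn {j} (onQubit j M) := by
  refine ⟨Matrix.of fun a b => M (a ⟨j, by simp⟩) (b ⟨j, by simp⟩), fun x y => ?_⟩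
  simp [onQubit]

/-- Only one intermediate index survives: `A` fixes it to `x` off `S`, and `B` fixes it to `y` off
`T`, hence on `S`. -/
theorem SupportedOn.mul_apply (hA : SupportedOn S A) (hB : SupportedOn T B)
    (hST : Disjoint S T) (x y : QBasis n) :
    (A * B) x y = A x (fun i => if i ∈ S then y i else x i) *
      B (fun i => if i ∈ S then y i else x i) y := by
  rw [supportedOn_iff] at hA hB
  rw [Matrix.mul_apply]
  refine Finset.sum_eq_single _ (fun z _ hz => ?_) (by simp)
  by_contra hc
  apply hz
  ext1 i
  split_ifs with hi
  · exact hB.1 _ _ (right_ne_zero_of_mul hc) i (Finset.disjoint_left.1 hST hi)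
  · exact (hA.1 _ _ (left_ne_zero_of_mul hc) i hi).symm

theorem SupportedOn.commute (hA : SupportedOn S A) (hB : SupportedOn T B)
    (hST : Disjoint S T) : Commute A B := by
  change A * B = B * A
  ext x y
  rw [hA.mul_apply hB hST, hB.mul_apply hA hST.symm, mul_comm]
  rw [supportedOn_iff] at hA hB
  have hd : ∀ i ∈ S, i ∉ T := fun i hi => Finset.disjoint_left.1 hST hi
  by_cases hxy : ∀ i, i ∉ S → i ∉ T → x i = y i
  · congr 1
    · clear hA
      apply hB.2 <;> clear hB <;> grind
    · clear hB
      apply hA.2 <;> clear hA <;> grind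
  · push Not at hxy
    obtain ⟨i, hiS, hiT, hi⟩ := hxy
    have h1 : B (fun i => if i ∈ S then y i else x i) y = 0 := by
      by_contra hc
      have := hB.1 _ _ hc i hiT
      rw [if_neg hiS] at this
      exact hi this
    have h2 : B x (fun i => if i ∈ T then y i else x i) = 0 ∨
        A (fun i => if i ∈ T then y i else x i) y = 0 := by
      right
      by_contra hc
      have := hA.1 _ _ hc i hiS
      rw [if_neg hiT] at this
      exact hi this
    rw [h1, zero_mul]
    rcases h2 with h2 | h2 <;> rw [h2] <;> simp

/-- Converse of `SupportedOn.commute_onQubit`. Support becomes a commutant condition, which is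
visibly monotone in `S` and stable under products. -/
theorem SupportedOn.of_commute
    (h : ∀ i, i ∉ S → ∀ M : Matrix (Fin 2) (Fin 2) ℂ, Commute A (onQubit i M)) :
    SupportedOn S A := by
  -- Commutation with the matrix unit `|a⟩⟨b|` on qubit `i`, read off at entry `(x, y)`.
  have entry : ∀ i, i ∉ S → ∀ (a b : Fin 2) (x y : QBasis n), y i = b →
      (if x i = a then A (Function.update x i b) y else 0) =
        A x (Function.update y i a) := by
    intro i hi a b x y hy
    have hc : onQubit i (Matrix.single a b 1) * A = A * onQubit i (Matrix.single a b 1) :=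
      (h i hi _).symm
    have := congrFun (congrFun hc x) y
    rw [Matrix.mul_apply, Matrix.mul_apply, Finset.sum_eq_single (Function.update x i b),
      Finset.sum_eq_single (Function.update y i a)] at this
    · simp only [onQubit, Matrix.of_apply] at this
      rw [if_pos (by intro k hk; simp [hk]), if_pos (by intro k hk; simp [hk])] at this
      simp only [Matrix.single_apply] at this
      simpa [hy, eq_comm] using this
    · intro z _ hz
      simp only [onQubit, Matrix.of_apply, Matrix.single_apply]
      split_ifs with h1 h2
      · exact absurd (by ext1 k; by_cases hk : k = i
                         · subst hk; simp [h2.1]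
                         · simp [hk, h1 k hk]) hz
      all_goals simp
    · simp
    · intro z _ hz
      simp only [onQubit, Matrix.of_apply, Matrix.single_apply]
      split_ifs with h1 h2
      · exact absurd (by ext1 k; by_cases hk : k = i
                         · subst hk; simp [h2.2]
                         · simp [hk, h1 k hk]) hz
      all_goals simp
    · simp
  have diag : ∀ x y, A x y ≠ 0 → ∀ i, i ∉ S → x i = y i := by
    intro x y hxy i hi
    by_contra hne
    have := entry i hi (y i) (y i) x y rfl
    rw [if_neg hne, Function.update_eq_self] at this
    exact hxy this.symm
  have flip : ∀ i, i ∉ S → ∀ (b : Fin 2) (x y : QBasis n), x i = y i →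
      A (Function.update x i b) (Function.update y i b) = A x y := by
    intro i hi b x y hxy
    have := entry i hi (x i) b x (Function.update y i b) (by simp)
    rw [if_pos rfl, Function.update_idem, hxy, Function.update_eq_self] at this
    exact this
  refine supportedOn_iff.2 ⟨diag, ?_⟩
  -- The coordinates outside `S` are changed one at a time by `flip`.
  have key : ∀ (R : Finset (Fin n)), Disjoint R S → ∀ x y x' y' : QBasis n,
      (∀ i ∈ R, x i = y i) → (∀ i ∈ R, x' i = y' i) → (∀ i, i ∉ R → x i = x' i) →
      (∀ i, i ∉ R → y i = y' i) → A x y = A x' y' := by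
    intro R
    induction R using Finset.induction_on with
    | empty =>
      intro _ x y x' y' _ _ hx hy
      rw [funext fun i => hx i (by simp), funext fun i => hy i (by simp)]
    | insert j R hj ih =>
      intro hd x y x' y' h1 h2 hx hy
      rw [Finset.disjoint_insert_left] at hd
      rw [← flip j hd.1 (x' j) x y (h1 j (by simp))]
      have h2j := h2 j (by simp)
      refine ih hd.2 _ _ _ _ ?_ ?_ ?_ ?_
      · intro i hi
        by_cases hij : i = j
        · subst hij; simp
        · simp [hij, h1 i (Finset.mem_insert_of_mem hi)]
      · exact fun i hi => h2 i (Finset.mem_insert_of_mem hi)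
      · intro i hi
        by_cases hij : i = j
        · subst hij; simp
        · simp [hij, hx i (by simp [hij, hi])]
      · intro i hi
        by_cases hij : i = j
        · subst hij; simp [h2j]
        · simp [hij, hy i (by simp [hij, hi])]
  intro x y x' y' h h' hx hy
  refine key Sᶜ disjoint_compl_left x y x' y' ?_ ?_ ?_ ?_ <;> intro i hi <;>
    simp at hi <;> simp_all

theorem SupportedOn.commute_onQubit (hA : SupportedOn S A) {i : Fin n} (hi : i ∉ S)
    (M : Matrix (Fin 2) (Fin 2) ℂ) : Commute A (onQubit i M) :=
  hA.commute (supportedOn_onQubit i M) (Finset.disjoint_singleton_right.2 hi)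

theorem SupportedOn.mono (hA : SupportedOn S A) (hST : S ⊆ T) : SupportedOn T A :=
  .of_commute fun _ hi M => hA.commute_onQubit (fun h => hi (hST h)) M

theorem SupportedOn.mul (hA : SupportedOn S A) (hB : SupportedOn S B) :
    SupportedOn S (A * B) :=
  .of_commute fun _ hi M => (hA.commute_onQubit hi M).mul_left (hB.commute_onQubit hi M)

end Support

/-! ### Light cone of a circuit -/

section LightCone

variable {n : ℕ} [NeZero n]

theorem toOp_mul (U V : SP n) : toOp (U * V) = toOp U * toOp V := rfl

theorem toOp_one : toOp (1 : SP n) = 1 := rfl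

theorem toOp_mul_conjTranspose (U : SP n) : toOp U * (toOp U)ᴴ = 1 :=
  Matrix.mem_unitaryGroup_iff.1 U.1.2

theorem conjTranspose_mul_toOp (U : SP n) : (toOp U)ᴴ * toOp U = 1 :=
  Matrix.mem_unitaryGroup_iff'.1 U.1.2

/-- `R` collects the gates that may enlarge the support. The middle clause keeps `R` disjoint from
every gate still to come, so that a gate missing `S` commutes with the evolved operator and cancels.
-/
theorem supportedOn_conj_gates {S : Finset (Fin n)} {A : QOp n} (hA : SupportedOn S A)
    (l : List (Finset (Fin n) × SP n)) (hl : ∀ g ∈ l, SupportedOn g.1 (toOp g.2))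
    (hd : l.Pairwise (fun g h => Disjoint g.1 h.1)) (T : Finset (Fin n))
    (hT : ∀ g ∈ l, Disjoint g.1 S ∨ g.1 ⊆ T) :
    ∃ R ⊆ T, (∀ s : Finset (Fin n), (∀ g ∈ l, Disjoint s g.1) → Disjoint s R) ∧
      SupportedOn (S ∪ R) (toOp (l.map Prod.snd).prod * A * (toOp (l.map Prod.snd).prod)ᴴ) := by
  induction l with
  | nil => exact ⟨∅, by simp, by simp, by simpa [toOp_one] using hA⟩
  | cons g l ih =>
    rw [List.pairwise_cons] at hd
    obtain ⟨R, hRT, hR, hsupp⟩ := ih (fun h hh => hl h (List.mem_cons_of_mem _ hh)) hd.2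
      (fun h hh => hT h (List.mem_cons_of_mem _ hh))
    have hg := hl g List.mem_cons_self
    set B := toOp (l.map Prod.snd).prod * A * (toOp (l.map Prod.snd).prod)ᴴ with hB
    have hconj : toOp ((g :: l).map Prod.snd).prod * A * (toOp ((g :: l).map Prod.snd).prod)ᴴ
        = toOp g.2 * B * (toOp g.2)ᴴ := by
      rw [List.map_cons, List.prod_cons, toOp_mul, Matrix.conjTranspose_mul, hB]
      simp only [Matrix.mul_assoc]
    rw [hconj]
    rcases hT g List.mem_cons_self with hgS | hgT
    · refine ⟨R, hRT, fun s hs => hR s fun h hh => hs h (List.mem_cons_of_mem _ hh), ?_⟩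
      have hdis : Disjoint g.1 (S ∪ R) :=
        Finset.disjoint_union_right.2 ⟨hgS, hR _ hd.1⟩
      have hc : toOp g.2 * B = B * toOp g.2 := hg.commute hsupp hdis
      rw [hc, Matrix.mul_assoc, toOp_mul_conjTranspose, Matrix.mul_one]
      exact hsupp
    · refine ⟨R ∪ g.1, Finset.union_subset hRT hgT, fun s hs => ?_, ?_⟩
      · exact Finset.disjoint_union_right.2 ⟨hR s fun h hh => hs h (List.mem_cons_of_mem _ hh),
          hs g List.mem_cons_self⟩
      · have hg' : SupportedOn (S ∪ (R ∪ g.1)) (toOp g.2) :=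
          hg.mono fun i hi => by simp [hi]
        exact (hg'.mul (hsupp.mono fun i hi => by simp at hi ⊢; tauto)).mul hg'.conjTranspose

theorem supportedOn_conj_layer {ℓ : ℕ} {A : QOp n}
    (hA : SupportedOn (Finset.univ.filter fun i : Fin n => (i : ℕ) ≤ ℓ) A) {W : SP n}
    (hW : IsLayer W) :
    SupportedOn (Finset.univ.filter fun i : Fin n => (i : ℕ) ≤ ℓ + 1)
      (toOp W * A * (toOp W)ᴴ) := by
  obtain ⟨l, hl, hd, rfl⟩ := hW
  obtain ⟨R, hR, -, h⟩ := supportedOn_conj_gates hA l (fun g hg => (hl g hg).2) hd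
    (Finset.univ.filter fun i : Fin n => (i : ℕ) ≤ ℓ + 1) (by
      intro g hg
      obtain ⟨i, j, hij, hji, hs⟩ := (hl g hg).1
      rw [hs]
      -- A bond whose left end is at most `ℓ` ends by `ℓ + 1`; any other bond misses the light cone.
      by_cases hi : (i : ℕ) ≤ ℓ
      · right
        intro k hk
        simp only [Finset.mem_insert, Finset.mem_singleton] at hk
        simp only [Finset.mem_filter, Finset.mem_univ, true_and]
        rcases hk with rfl | rfl <;> omega
      · left
        rw [Finset.disjoint_left]
        intro k hk
        simp only [Finset.mem_insert, Finset.mem_singleton] at hk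
        simp only [Finset.mem_filter, Finset.mem_univ, true_and]
        rcases hk with rfl | rfl <;> omega)
  refine h.mono (Finset.union_subset (fun i hi => ?_) hR)
  simp only [Finset.mem_filter, Finset.mem_univ, true_and] at hi ⊢
  omega

theorem supportedOn_conj_circuit {L : ℕ} {U : SP n} (hU : U ∈ circuits n L)
    (M : Matrix (Fin 2) (Fin 2) ℂ) :
    SupportedOn (Finset.univ.filter fun i : Fin n => (i : ℕ) ≤ L)
      (toOp U * onQubit 0 M * (toOp U)ᴴ) := by
  obtain ⟨l, rfl, hl, rfl⟩ := hU
  induction l with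
  | nil =>
    refine SupportedOn.mono (S := {0}) ?_ (by simp)
    simpa [toOp_one] using supportedOn_onQubit 0 M
  | cons W l ih =>
    have := supportedOn_conj_layer (ih fun V hV => hl V (List.mem_cons_of_mem _ hV))
      (hl W List.mem_cons_self)
    rw [List.prod_cons, toOp_mul, Matrix.conjTranspose_mul]
    simpa only [Matrix.mul_assoc, List.length_cons] using this

end LightCone

/-! ### Lower bounds for the trace norm -/

section TraceNorm

variable {κ ι : Type*} [Fintype κ] [DecidableEq κ] [Fintype ι] [DecidableEq ι]

/-- Take the trace in an eigenbasis `v i` of `Aᴴ * A`. By Cauchy–Schwarz each term is at most `‖W A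
v i‖ = ‖A v i‖`, the corresponding singular value. -/
theorem re_trace_mul_le_traceNorm {W : Matrix κ κ ℂ} (hW : Wᴴ * W = 1) (A : Matrix κ κ ℂ) :
    (W * A).trace.re ≤ traceNorm A := by
  set hH := Matrix.isHermitian_conjTranspose_mul_self A
  set v : κ → κ → ℂ := fun i => (hH.eigenvectorBasis i).ofLp with hv
  have hWn : ∀ x : κ → ℂ, star (W *ᵥ x) ⬝ᵥ (W *ᵥ x) = star x ⬝ᵥ x := by
    intro x
    rw [Matrix.star_mulVec, ← Matrix.dotProduct_mulVec, Matrix.mulVec_mulVec, hW,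
      Matrix.one_mulVec]
  have hnorm : ∀ x : κ → ℂ, ‖WithLp.toLp 2 x‖ ^ 2 = (star x ⬝ᵥ x).re := by
    intro x
    rw [EuclideanSpace.norm_sq_eq, dotProduct, Complex.re_sum]
    refine Finset.sum_congr rfl fun i _ => ?_
    simp [← Complex.normSq_eq_norm_sq, Complex.normSq_apply]
  have htr : (W * A).trace = ∑ i, star (v i) ⬝ᵥ ((W * A) *ᵥ v i) := by
    have hU := hH.eigenvectorUnitary.2
    set U : Matrix κ κ ℂ := (hH.eigenvectorUnitary : Matrix κ κ ℂ)
    have h1 : U * Uᴴ = 1 := Matrix.mem_unitaryGroup_iff.1 hU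
    calc (W * A).trace = (Uᴴ * ((W * A) * U)).trace := by
          rw [Matrix.trace_mul_comm Uᴴ, Matrix.mul_assoc, h1, Matrix.mul_one]
      _ = _ := by
          rw [Matrix.trace]
          refine Finset.sum_congr rfl fun i _ => ?_
          rw [Matrix.diag_apply, Matrix.mul_apply, dotProduct]
          rfl
  rw [htr, Complex.re_sum, traceNorm]
  refine Finset.sum_le_sum fun i _ => ?_
  have hA2 : ‖WithLp.toLp 2 (W *ᵥ (A *ᵥ v i))‖ ^ 2 = hH.eigenvalues i := by
    rw [hnorm, hWn, Matrix.star_mulVec, ← Matrix.dotProduct_mulVec, Matrix.mulVec_mulVec,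
      hH.eigenvalues_eq i]
    rfl
  have hv1 : ‖WithLp.toLp 2 (v i)‖ = 1 := hH.eigenvectorBasis.orthonormal.1 i
  have hcs : (star (v i) ⬝ᵥ ((W * A) *ᵥ v i)) =
      inner ℂ (WithLp.toLp 2 (v i)) (WithLp.toLp 2 (W *ᵥ (A *ᵥ v i))) := by
    rw [EuclideanSpace.inner_eq_star_dotProduct, ← Matrix.mulVec_mulVec, dotProduct_comm]
  rw [hcs]
  refine (Complex.re_le_norm _).trans ((norm_inner_le_norm _ _).trans ?_)
  rw [hv1, one_mul, ← hA2, Real.sqrt_sq (norm_nonneg _)]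

/-- Measuring in an orthonormal basis, given by the columns of `V`, bounds the trace norm. -/
theorem sum_le_traceNorm {V : Matrix κ ι ℂ} (h1 : V * Vᴴ = 1) (h2 : Vᴴ * V = 1)
    {c : ι → ℝ} (hc : ∀ p, c p ^ 2 = 1) (A : Matrix κ κ ℂ) :
    ∑ p, c p * ((Vᴴ * A * V) p p).re ≤ traceNorm A := by
  -- The signed sum is the trace of `A` against the unitary `V * D * Vᴴ`.
  set D : Matrix ι ι ℂ := Matrix.diagonal fun p => (c p : ℂ) with hD
  have hDD : Dᴴ * D = 1 := by
    rw [hD, Matrix.diagonal_conjTranspose, Matrix.diagonal_mul_diagonal, ← Matrix.diagonal_one]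
    congr 1
    ext1 p
    simp only [Pi.star_apply, RCLike.star_def, Complex.conj_ofReal]
    rw [← sq]
    exact_mod_cast hc p
  have hW : (V * D * Vᴴ)ᴴ * (V * D * Vᴴ) = 1 := by
    simp only [Matrix.conjTranspose_mul, Matrix.conjTranspose_conjTranspose]
    calc _ = V * (Dᴴ * (Vᴴ * V) * D) * Vᴴ := by simp only [Matrix.mul_assoc]
      _ = 1 := by rw [h2, Matrix.mul_one, hDD, Matrix.mul_one, h1]
  refine le_of_eq_of_le ?_ (re_trace_mul_le_traceNorm hW A)
  have : (V * D * Vᴴ * A).trace = (D * (Vᴴ * A * V)).trace := by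
    rw [Matrix.mul_assoc, Matrix.mul_assoc, Matrix.trace_mul_comm]
    simp only [Matrix.mul_assoc]
  rw [this, Matrix.trace, Complex.re_sum]
  refine Finset.sum_congr rfl fun p _ => ?_
  rw [Matrix.diag_apply, hD, Matrix.diagonal_mul]
  simp

end TraceNorm

/-! ### Pauli strings -/

section Pauli

/-- The Pauli matrices `𝟙, X, Y, Z`. -/
def pauli : Fin 4 → Matrix (Fin 2) (Fin 2) ℂ := ![1, !![0, 1; 1, 0], pauliY, pauliZ]

/-- `±1` according to whether two Pauli matrices commute or anticommute. -/
def pauliComm (a b : Fin 4) : ℤ := if a = 0 ∨ b = 0 ∨ a = b then 1 else -1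

/-- `±1` according to whether a Pauli matrix is symmetric or antisymmetric. -/
def pauliSymm (a : Fin 4) : ℤ := if a = 2 then -1 else 1

theorem pauli_conjTranspose (a : Fin 4) : (pauli a)ᴴ = pauli a := by
  fin_cases a <;> ext i j <;> fin_cases i <;> fin_cases j <;>
    simp [pauli, pauliY, pauliZ]

theorem pauli_mul_self (a : Fin 4) : pauli a * pauli a = 1 := by
  fin_cases a <;> ext i j <;> fin_cases i <;> fin_cases j <;>
    simp [pauli, pauliY, pauliZ, Matrix.mul_apply]

theorem pauli_transpose (a : Fin 4) : (pauli a)ᵀ = (pauliSymm a : ℂ) • pauli a := by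
  fin_cases a <;> ext i j <;> fin_cases i <;> fin_cases j <;>
    simp [pauli, pauliY, pauliZ, pauliSymm]

theorem pauli_mul_comm (a b : Fin 4) :
    pauli a * pauli b = (pauliComm a b : ℂ) • (pauli b * pauli a) := by
  fin_cases a <;> fin_cases b <;> ext i j <;> fin_cases i <;> fin_cases j <;>
    simp [pauli, pauliY, pauliZ, pauliComm, Matrix.mul_apply]

theorem trace_pauli_mul (a b : Fin 4) :
    (pauli a * pauli b).trace = if a = b then 2 else 0 := by
  fin_cases a <;> fin_cases b <;>
    simp [pauli, pauliY, pauliZ, Matrix.trace, one_add_one_eq_two]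

variable {n : ℕ}

/-- The Pauli string with label `p`. -/
def pauliString (p : Fin n → Fin 4) : QOp n := tensorOp fun i => pauli (p i)

theorem pauliString_conjTranspose (p : Fin n → Fin 4) : (pauliString p)ᴴ = pauliString p := by
  simp [pauliString, tensorOp_conjTranspose, pauli_conjTranspose]

theorem pauliString_mul_self (p : Fin n → Fin 4) : pauliString p * pauliString p = 1 := by
  simp [pauliString, tensorOp_mul, pauli_mul_self, tensorOp_one]

theorem pauliString_transpose (p : Fin n → Fin 4) :
    (pauliString p)ᵀ = ((∏ i, pauliSymm (p i) : ℤ) : ℂ) • pauliString p := by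
  simp only [pauliString, tensorOp_transpose, pauli_transpose, tensorOp_smul]
  push_cast
  rfl

theorem pauliString_mul_comm (p q : Fin n → Fin 4) :
    pauliString p * pauliString q =
      ((∏ i, pauliComm (p i) (q i) : ℤ) : ℂ) • (pauliString q * pauliString p) := by
  simp only [pauliString, tensorOp_mul]
  rw [funext fun i => pauli_mul_comm (p i) (q i), tensorOp_smul]
  push_cast
  rfl

theorem trace_pauliString_mul (p q : Fin n → Fin 4) :
    (pauliString p * pauliString q).trace = if p = q then 2 ^ n else 0 := by
  simp only [pauliString, tensorOp_mul, trace_tensorOp, trace_pauli_mul, Finset.prod_ite_zero]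
  simp [funext_iff]

theorem onQubit_pauli (j : Fin n) (a : Fin 4) :
    onQubit j (pauli a) = pauliString (Pi.single j a) := by
  rw [onQubit_eq_tensorOp, pauliString]
  congr 1
  ext1 i
  by_cases h : i = j
  · subst h; simp
  · simp [h, pauli]

/-- A Pauli matrix on qubit `j` anticommuting with `p j` commutes with `A`; conjugation by it
reverses the sign of the trace. -/
theorem trace_pauliString_mul_eq_zero {S : Finset (Fin n)} {A : QOp n} (hA : SupportedOn S A)
    {p : Fin n → Fin 4} {j : Fin n} (hj : j ∉ S) (hp : p j ≠ 0) :
    (pauliString p * A).trace = 0 := by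
  obtain ⟨b, hb⟩ : ∃ b, pauliComm b (p j) = -1 := by
    have : ∀ a : Fin 4, a ≠ 0 → ∃ b, pauliComm b a = -1 := by decide
    exact this _ hp
  have hc : onQubit j (pauli b) * A = A * onQubit j (pauli b) :=
    (hA.commute_onQubit hj _).symm
  rw [onQubit_pauli] at hc
  set Q := pauliString (Pi.single j b) with hQ
  have hanti : Q * pauliString p = -(pauliString p * Q) := by
    rw [hQ, pauliString_mul_comm]
    rw [Fintype.prod_eq_single j (fun i hi => by simp [hi, pauliComm])]
    simp [hb]
  have h1 : (pauliString p * A).trace = -(pauliString p * A).trace := by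
    calc (pauliString p * A).trace = (pauliString p * A * (Q * Q)).trace := by
          rw [hQ, pauliString_mul_self, Matrix.mul_one]
      _ = (Q * pauliString p * A * Q).trace := by
          rw [← Matrix.mul_assoc, Matrix.trace_mul_comm]
          simp only [Matrix.mul_assoc]
      _ = -(pauliString p * (Q * A) * Q).trace := by
          rw [hanti]
          simp only [Matrix.neg_mul, Matrix.trace_neg, Matrix.mul_assoc]
      _ = -(pauliString p * A * (Q * Q)).trace := by
          rw [hc]
          simp only [Matrix.mul_assoc]
      _ = _ := by rw [hQ, pauliString_mul_self, Matrix.mul_one]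
  exact self_eq_neg.1 h1

end Pauli

/-! ### Symplectic conjugation of Pauli strings -/

section Symplectic

variable {n : ℕ} [NeZero n]

/-- `1` if the Pauli string `P` satisfies `Pᵀ Ω = -Ω P`, and `-1` otherwise. -/
def sympSign (p : Fin n → Fin 4) : ℤ :=
  ∏ i, if i = 0 then (if p i = 0 then -1 else 1) else pauliSymm (p i)

theorem sympForm_eq : sympForm n = Complex.I • pauliString (Pi.single 0 2) := by
  rw [← onQubit_pauli, sympForm]
  ext x y
  simp only [onQubit, Matrix.of_apply, Matrix.smul_apply, smul_eq_mul, mul_ite, mul_zero]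
  rfl

theorem sympForm_conjTranspose : (sympForm n)ᴴ = -sympForm n := by
  rw [sympForm_eq, Matrix.conjTranspose_smul, pauliString_conjTranspose]
  simp

theorem sympForm_mul_self : sympForm n * sympForm n = -1 := by
  rw [sympForm_eq, Matrix.smul_mul, Matrix.mul_smul, pauliString_mul_self, smul_smul]
  simp

/-- The sign comes from transposing each factor and moving the string past `Y₁`. The global minus
sign is absorbed at qubit `0`, where only the identity then contributes `-1`. -/
theorem pauliString_transpose_mul_sympForm (p : Fin n → Fin 4) :
    (pauliString p)ᵀ * sympForm n = -((sympSign p : ℂ) • (sympForm n * pauliString p)) := by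
  have hs : sympSign p =
      -((∏ i, pauliSymm (p i)) * ∏ i, pauliComm (p i) ((Pi.single 0 2 : Fin n → Fin 4) i)) := by
    rw [← Finset.prod_mul_distrib, sympSign, ← Finset.mul_prod_erase _ _ (Finset.mem_univ 0),
      ← Finset.mul_prod_erase _ (fun i => _ * _) (Finset.mem_univ 0), ← neg_mul]
    congr 1
    · have : ∀ a : Fin 4, (if a = 0 then -1 else 1) = -(pauliSymm a * pauliComm a 2) := by decide
      rw [if_pos rfl, Pi.single_eq_same]
      exact this (p 0)
    · refine Finset.prod_congr rfl fun i hi => ?_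
      simp [Finset.ne_of_mem_erase hi, pauliComm]
  rw [pauliString_transpose, sympForm_eq, Matrix.smul_mul, Matrix.mul_smul,
    pauliString_mul_comm, hs, Int.cast_neg, Int.cast_mul, Matrix.smul_mul, neg_smul, neg_neg]
  simp only [smul_smul]
  congr 1
  ring

theorem sympSign_eq (p : Fin n → Fin 4) : sympSign p = 1 ∨ sympSign p = -1 := by
  unfold sympSign
  refine Finset.prod_induction _ (fun a : ℤ => a = 1 ∨ a = -1) ?_ (Or.inl rfl) ?_
  · rintro a b (rfl | rfl) (rfl | rfl) <;> simp
  · intro i _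
    unfold pauliSymm
    split_ifs <;> simp

theorem toOp_transpose_mul (U : SP n) : (toOp U)ᵀ * sympForm n * toOp U = sympForm n := U.2

theorem sympForm_mul_toOp (U : SP n) :
    (toOp U)ᵀ * sympForm n = sympForm n * (toOp U)ᴴ := by
  conv_rhs => rw [← toOp_transpose_mul U, Matrix.mul_assoc, toOp_mul_conjTranspose,
    Matrix.mul_one]

/-- Two anticommuting Hermitian involutions in the complexified Lie algebra are conjugate. -/
theorem exists_conj_of_anticommute {P Q : QOp n} (hP : Pᴴ = P) (hQ : Qᴴ = Q) (hP2 : P * P = 1)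
    (hQ2 : Q * Q = 1) (hPQ : Q * P = -(P * Q)) (hPs : Pᵀ * sympForm n = -(sympForm n * P))
    (hQs : Qᵀ * sympForm n = -(sympForm n * Q)) :
    ∃ V : SP n, toOp V * P * (toOp V)ᴴ = Q := by
  have hsq : (P + Q) * (P + Q) = (2 : ℂ) • 1 := by
    rw [Matrix.add_mul, Matrix.mul_add, Matrix.mul_add, hP2, hQ2, hPQ, two_smul]
    abel
  have hr : ((√2 : ℝ) : ℂ)⁻¹ * ((√2 : ℝ) : ℂ)⁻¹ * 2 = 1 := by
    rw [← mul_inv, ← Complex.ofReal_mul, Real.mul_self_sqrt (by norm_num)]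
    norm_num
  set r : ℂ := ((√2 : ℝ) : ℂ)⁻¹ with hrdef
  have hrs : star r = r := by simp [hrdef]
  -- `(P + Q) / √2` is a Hermitian involution exchanging `P` and `Q`. The factor `i` makes `W * W =
  -- -1`, which turns `Wᵀ Ω = -Ω W` into `Wᵀ Ω W = Ω`.
  set W : QOp n := (Complex.I * r) • (P + Q) with hW
  have hWH : Wᴴ = -W := by
    rw [hW, Matrix.conjTranspose_smul, Matrix.conjTranspose_add, hP, hQ, star_mul, hrs,
      ← neg_smul]
    simp [mul_comm]
  have hWW : W * W = -1 := by
    rw [hW, Matrix.smul_mul, Matrix.mul_smul, hsq, smul_smul, smul_smul,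
      ← neg_one_smul ℂ (1 : QOp n)]
    congr 1
    linear_combination Complex.I ^ 2 * hr + Complex.I_sq
  have hWs : Wᵀ * sympForm n * W = sympForm n := by
    have : Wᵀ * sympForm n = -(sympForm n * W) := by
      rw [hW, Matrix.transpose_smul, Matrix.transpose_add, Matrix.smul_mul, Matrix.add_mul, hPs,
        hQs, Matrix.mul_smul, Matrix.mul_add, ← smul_neg, neg_add]
    rw [this, Matrix.neg_mul, Matrix.mul_assoc, hWW, Matrix.mul_neg, neg_neg, Matrix.mul_one]
  have hu : W ∈ Matrix.unitaryGroup (QBasis n) ℂ := by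
    rw [Matrix.mem_unitaryGroup_iff, Matrix.star_eq_conjTranspose, hWH, Matrix.mul_neg, hWW,
      neg_neg]
  refine ⟨⟨⟨W, hu⟩, hWs⟩, ?_⟩
  change W * P * Wᴴ = Q
  have hPQP : (P + Q) * P * (P + Q) = (2 : ℂ) • Q := by
    have e1 : Q * P * Q = -P := by rw [hPQ, Matrix.neg_mul, Matrix.mul_assoc, hQ2, Matrix.mul_one]
    have e2 : Q * P * P = Q := by rw [Matrix.mul_assoc, hP2, Matrix.mul_one]
    rw [Matrix.add_mul, hP2, Matrix.add_mul, Matrix.one_mul, Matrix.mul_add, e1, e2, two_smul]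
    abel
  rw [hWH, hW, Matrix.mul_neg, Matrix.smul_mul, Matrix.smul_mul, Matrix.mul_smul, hPQP, smul_smul,
    smul_smul, ← neg_smul]
  nth_rewrite 2 [← one_smul ℂ Q]
  congr 1
  linear_combination (-Complex.I ^ 2) * hr - Complex.I_sq

theorem exists_conj_pauliString_of_comm {p q : Fin n → Fin 4} (hp : sympSign p = 1)
    (hq : sympSign q = 1) (hpq : ∏ i, pauliComm (q i) (p i) = -1) :
    ∃ V : SP n, toOp V * pauliString p * (toOp V)ᴴ = pauliString q := by
  refine exists_conj_of_anticommute (pauliString_conjTranspose p) (pauliString_conjTranspose q)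
    (pauliString_mul_self p) (pauliString_mul_self q) ?_ ?_ ?_
  · rw [pauliString_mul_comm, hpq]; simp
  · rw [pauliString_transpose_mul_sympForm, hp]; simp
  · rw [pauliString_transpose_mul_sympForm, hq]; simp

theorem sympSign_single_zero {a : Fin 4} (ha : a ≠ 0) :
    sympSign (Pi.single 0 a : Fin n → Fin 4) = 1 := by
  refine Finset.prod_eq_one fun i _ => ?_
  by_cases h : i = 0
  · subst h; simp [ha]
  · simp [h, pauliSymm]

/-- The symplectic group acts transitively on the Pauli strings in its complexified Lie
algebra. -/
theorem exists_conj_pauliString {p : Fin n → Fin 4} (hp : sympSign p = 1) :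
    ∃ V : SP n, toOp V * pauliString (Pi.single 0 3) * (toOp V)ᴴ = pauliString p := by
  have h3 : sympSign (Pi.single 0 3 : Fin n → Fin 4) = 1 := sympSign_single_zero (by decide)
  have hcomm : ∀ (q : Fin n → Fin 4) (a : Fin 4),
      ∏ i, pauliComm (q i) ((Pi.single 0 a : Fin n → Fin 4) i) = pauliComm (q 0) a := by
    intro q a
    rw [Fintype.prod_eq_single 0 (fun i hi => by simp [hi, pauliComm])]
    simp
  -- If `p` commutes with `Z₁`, go through an intermediate string `q` anticommuting with both.
  have step : ∀ q : Fin n → Fin 4, sympSign q = 1 → pauliComm (q 0) 3 = -1 →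
      ∏ i, pauliComm (p i) (q i) = -1 →
      ∃ V : SP n, toOp V * pauliString (Pi.single 0 3) * (toOp V)ᴴ = pauliString p := by
    intro q hq h1 h2
    obtain ⟨V, hV⟩ := exists_conj_pauliString_of_comm h3 hq (by rw [hcomm, h1])
    obtain ⟨V', hV'⟩ := exists_conj_pauliString_of_comm hq hp h2
    refine ⟨V' * V, ?_⟩
    rw [← hV', ← hV, toOp_mul, Matrix.conjTranspose_mul]
    simp only [Matrix.mul_assoc]
  by_cases hc : pauliComm (p 0) 3 = -1
  · exact exists_conj_pauliString_of_comm h3 hp (by rw [hcomm, hc])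
  by_cases h0 : p 0 = 0
  -- With the identity on qubit `0`, sign `1` forces a `Y` elsewhere; the intermediate string is
  -- then `X₁ Z_j`.
  · obtain ⟨j, hj0, hj⟩ : ∃ j, j ≠ 0 ∧ p j = 2 := by
      by_contra! hcon
      have : sympSign p = -1 := by
        rw [sympSign, Fintype.prod_eq_single 0 (fun i hi => by simp [hi, pauliSymm, hcon i hi])]
        simp [h0]
      omega
    refine step (Function.update (Pi.single 0 1) j 3) ?_ ?_ ?_
    · refine Finset.prod_eq_one fun i _ => ?_
      by_cases hi : i = 0
      · subst hi; simp [hj0.symm]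
      · by_cases hij : i = j
        · subst hij; simp [hi, pauliSymm]
        · simp [hi, hij, pauliSymm]
    · simp [hj0.symm, pauliComm]
    · rw [Fintype.prod_eq_single j]
      · simp [hj, pauliComm]
      · intro i hij
        by_cases hi : i = 0
        · subst hi; simp [h0, pauliComm]
        · simp [hi, hij, pauliComm]
  · have hp0 : p 0 = 3 := by
      have : ∀ a : Fin 4, ¬ pauliComm a 3 = -1 → a ≠ 0 → a = 3 := by decide
      exact this _ hc h0
    refine step (Pi.single 0 1) (sympSign_single_zero (by decide)) (by simp [pauliComm]) ?_
    rw [hcomm, hp0]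
    rfl

/-- The two operators lie in opposite eigenspaces of the trace-preserving anti-automorphism `X ↦ Ω⁻¹
Xᵀ Ω`. -/
theorem trace_pauliString_mul_conj_eq_zero {p : Fin n → Fin 4} (hp : sympSign p = -1) {A : QOp n}
    (hA : Aᵀ * sympForm n = -(sympForm n * A)) : (pauliString p * A).trace = 0 := by
  have hP := pauliString_transpose_mul_sympForm p
  rw [hp] at hP
  have hP' : (pauliString p)ᵀ = -(sympForm n * pauliString p * sympForm n) := by
    have : (pauliString p)ᵀ * sympForm n * sympForm n
        = sympForm n * pauliString p * sympForm n := by rw [hP]; simp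
    rw [Matrix.mul_assoc, sympForm_mul_self] at this
    rw [← this]; simp
  apply self_eq_neg.1
  calc (pauliString p * A).trace = (Aᵀ * (pauliString p)ᵀ).trace := by
        rw [← Matrix.trace_transpose, Matrix.transpose_mul]
    _ = -((Aᵀ * sympForm n) * pauliString p * sympForm n).trace := by
        rw [hP', Matrix.mul_neg, Matrix.trace_neg]
        simp only [Matrix.mul_assoc]
    _ = (sympForm n * sympForm n * A * pauliString p).trace := by
        rw [hA, Matrix.trace_mul_comm]
        simp only [Matrix.mul_assoc, Matrix.neg_mul, Matrix.mul_neg, Matrix.trace_neg, neg_neg]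
    _ = -(pauliString p * A).trace := by
        rw [sympForm_mul_self, Matrix.trace_mul_comm]
        simp

end Symplectic

/-! ### Vectorization and the diamond distance -/

section Vectorization

theorem le_diamondDist {κ ι : Type*} [Fintype κ] [DecidableEq κ] [Fintype ι] [DecidableEq ι]
    (Φ Ψ : Matrix κ κ ℂ → Matrix κ κ ℂ) {ρ : Matrix κ κ ℂ} (hρ : IsState ρ)
    {V : Matrix κ ι ℂ} (h1 : V * Vᴴ = 1) (h2 : Vᴴ * V = 1) {c : ι → ℝ} (hc : ∀ p, c p ^ 2 = 1) :
    ENNReal.ofReal (∑ p, c p * ((Vᴴ * (Φ ρ - Ψ ρ) * V) p p).re) ≤ diamondDist Φ Ψ := by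
  -- A one-dimensional ancilla suffices.
  let e : κ × Fin 1 ≃ κ := Equiv.prodUnique κ (Fin 1)
  have hst : IsState (ρ.submatrix e e) := by
    refine ⟨hρ.1.submatrix e, ?_⟩
    rw [← hρ.2, Matrix.trace, Matrix.trace]
    exact Fintype.sum_equiv e _ _ fun _ => rfl
  refine le_trans ?_ (le_iSup_of_le 1 (le_iSup_of_le (ρ.submatrix e e)
    (le_iSup_of_le hst le_rfl)))
  refine ENNReal.ofReal_le_ofReal ?_
  have hA : withAncilla (fun X => Φ X - Ψ X) 1 (ρ.submatrix e e)
      = (Φ ρ - Ψ ρ).submatrix e e := rfl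
  have h1' : V.submatrix e id * (V.submatrix e id)ᴴ = 1 := by
    rw [Matrix.conjTranspose_submatrix, ← Matrix.submatrix_mul _ _ _ _ _ Function.bijective_id,
      h1, Matrix.submatrix_one_equiv]
  have h2' : (V.submatrix e id)ᴴ * V.submatrix e id = 1 := by
    rw [Matrix.conjTranspose_submatrix, Matrix.submatrix_mul_equiv, h2, Matrix.submatrix_id_id]
  have := sum_le_traceNorm h1' h2' hc ((Φ ρ - Ψ ρ).submatrix e e)
  rw [Matrix.conjTranspose_submatrix, Matrix.submatrix_mul_equiv, Matrix.submatrix_mul_equiv,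
    Matrix.submatrix_id_id] at this
  rw [hA]
  exact this

variable {n : ℕ}

/-- An operator as a vector of the doubled system, normalized so that unitaries become unit
vectors. -/
def vecOp (A : QOp n) : (Fin 2 → QBasis n) → ℂ :=
  fun x => ((√(2 ^ n) : ℝ) : ℂ)⁻¹ * A (x 0) (x 1)

theorem star_vecOp_dotProduct (A B : QOp n) :
    star (vecOp A) ⬝ᵥ vecOp B = (Aᴴ * B).trace / 2 ^ n := by
  have hr : ((√(2 ^ n) : ℝ) : ℂ) * ((√(2 ^ n) : ℝ) : ℂ) = 2 ^ n := by
    rw [← Complex.ofReal_mul, Real.mul_self_sqrt (by positivity)]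
    push_cast
    rfl
  simp only [dotProduct, Matrix.trace, Matrix.diag, Matrix.mul_apply, Finset.sum_div]
  rw [Finset.sum_comm, ← Fintype.sum_prod_type']
  refine Fintype.sum_equiv (finTwoArrowEquiv _) _ _ fun x => ?_
  change star (vecOp A x) * vecOp B x = star (A (x 0) (x 1)) * B (x 0) (x 1) / 2 ^ n
  simp only [vecOp, star_mul', star_inv₀, RCLike.star_def, Complex.conj_ofReal, ← hr]
  rw [div_eq_mul_inv, mul_inv]
  ring

theorem tensorPow_mulVec_vecOp (U A : QOp n) :
    tensorPow 2 U *ᵥ vecOp A = vecOp (U * A * Uᵀ) := by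
  ext1 x
  simp only [Matrix.mulVec, dotProduct, vecOp, Matrix.mul_apply, Finset.sum_mul, Finset.mul_sum]
  rw [Finset.sum_comm, ← Fintype.sum_prod_type']
  refine Fintype.sum_equiv (finTwoArrowEquiv _) _ _ fun y => ?_
  change tensorPow 2 U x y * (_ * A (y 0) (y 1)) =
    _ * (U (x 0) (y 0) * A (y 0) (y 1) * U (x 1) (y 1))
  simp only [tensorPow, Matrix.of_apply, Fin.prod_univ_two]
  ring

end Vectorization

/-! ### Pauli strings on a set of qubits -/

section StringSupport

variable {n : ℕ}

/-- The labels of the Pauli strings supported on `S`. -/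
def stringsOn (S : Finset (Fin n)) : Finset (Fin n → Fin 4) :=
  Fintype.piFinset fun i => if i ∈ S then Finset.univ else {0}

theorem mem_stringsOn {S : Finset (Fin n)} {p : Fin n → Fin 4} :
    p ∈ stringsOn S ↔ ∀ i, i ∉ S → p i = 0 := by
  rw [stringsOn, Fintype.mem_piFinset]
  refine forall_congr' fun i => ?_
  split_ifs with h <;> simp [h]

theorem card_stringsOn (S : Finset (Fin n)) : (stringsOn S).card = 4 ^ S.card := by
  have : ∀ i, (if i ∈ S then (Finset.univ : Finset (Fin 4)) else {0}).card =
      if i ∈ S then 4 else 1 := fun i => by split_ifs <;> simp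
  rw [stringsOn, Fintype.card_piFinset]
  simp [this]

end StringSupport

/-! ### Outcome probabilities -/

section Weights

variable {n : ℕ} [NeZero n]

theorem sympForm_mul_conjTranspose_self : sympForm n * (sympForm n)ᴴ = 1 := by
  rw [sympForm_conjTranspose, Matrix.mul_neg, sympForm_mul_self, neg_neg]

theorem sympForm_mul_transpose_toOp (U : SP n) :
    sympForm n * (toOp U)ᵀ = (toOp U)ᴴ * sympForm n := by
  have h := congrArg (fun X => sympForm n * X * sympForm n) (sympForm_mul_toOp U)
  simp only [Matrix.mul_assoc, sympForm_mul_self] at h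
  rw [← Matrix.mul_assoc (sympForm n) (sympForm n), sympForm_mul_self] at h
  simpa [Matrix.mul_assoc] using h

/-- The orthonormal basis `|P Ω⟩⟩` of the doubled system, `P` running over the Pauli strings. -/
def pauliBasis (n : ℕ) [NeZero n] : Matrix (Fin 2 → QBasis n) (Fin n → Fin 4) ℂ :=
  Matrix.of fun x p => vecOp (pauliString p * sympForm n) x

theorem star_vecOp_mul_sympForm (A B : QOp n) :
    star (vecOp (A * sympForm n)) ⬝ᵥ vecOp (B * sympForm n) = (Aᴴ * B).trace / 2 ^ n := by
  rw [star_vecOp_dotProduct, Matrix.conjTranspose_mul, Matrix.mul_assoc, Matrix.trace_mul_comm,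
    Matrix.mul_assoc, Matrix.mul_assoc, sympForm_mul_conjTranspose_self, Matrix.mul_one]

theorem conjTranspose_mul_pauliBasis : (pauliBasis n)ᴴ * pauliBasis n = 1 := by
  ext p q
  have : ((pauliBasis n)ᴴ * pauliBasis n) p q =
      star (vecOp (pauliString p * sympForm n)) ⬝ᵥ vecOp (pauliString q * sympForm n) := rfl
  rw [this, star_vecOp_mul_sympForm, pauliString_conjTranspose, trace_pauliString_mul,
    Matrix.one_apply]
  split_ifs <;> simp

/-- There are `4 ^ n` strings, the dimension of the doubled system, so a one-sided inverse is
two-sided. -/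
theorem pauliBasis_mul_conjTranspose : pauliBasis n * (pauliBasis n)ᴴ = 1 := by
  refine (Matrix.mul_eq_one_comm_of_card_eq _ _ _ ?_).1 conjTranspose_mul_pauliBasis
  simp only [Fintype.card_pi, Fintype.card_fin, Finset.prod_const, Finset.card_univ]
  rw [← pow_mul, mul_comm, pow_mul]
  norm_num

/-- The operator `U Z₁ U†`. -/
def evolvedZ (U : SP n) : QOp n := toOp U * onQubit 0 pauliZ * (toOp U)ᴴ

theorem onQubit_pauliZ : onQubit 0 pauliZ = pauliString (Pi.single (0 : Fin n) 3) :=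
  onQubit_pauli 0 3

/-- The coefficient of the Pauli string `p` in `U Z₁ U†`. -/
def pauliCoeff (p : Fin n → Fin 4) (U : SP n) : ℂ :=
  (pauliString p * evolvedZ U).trace / 2 ^ n

theorem tensorPow_mulVec_evolved (U : SP n) :
    tensorPow 2 (toOp U) *ᵥ vecOp (onQubit 0 pauliZ * sympForm n) =
      vecOp (evolvedZ U * sympForm n) := by
  rw [tensorPow_mulVec_vecOp, evolvedZ]
  congr 1
  rw [Matrix.mul_assoc, Matrix.mul_assoc, sympForm_mul_transpose_toOp]
  simp only [Matrix.mul_assoc]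

theorem pauliBasis_mulVec_evolved (U : SP n) :
    (pauliBasis n)ᴴ *ᵥ vecOp (evolvedZ U * sympForm n) = fun p => pauliCoeff p U := by
  ext1 p
  have : ((pauliBasis n)ᴴ *ᵥ vecOp (evolvedZ U * sympForm n)) p =
      star (vecOp (pauliString p * sympForm n)) ⬝ᵥ vecOp (evolvedZ U * sympForm n) := rfl
  rw [this, star_vecOp_mul_sympForm, pauliString_conjTranspose, pauliCoeff]

theorem evolvedZ_conjTranspose_mul_self (U : SP n) : (evolvedZ U)ᴴ * evolvedZ U = 1 := by
  have hZ : (onQubit (0 : Fin n) pauliZ)ᴴ = onQubit 0 pauliZ := by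
    rw [onQubit_pauliZ, pauliString_conjTranspose]
  have hZ2 : onQubit (0 : Fin n) pauliZ * onQubit 0 pauliZ = 1 := by
    rw [onQubit_pauliZ, pauliString_mul_self]
  rw [evolvedZ, Matrix.conjTranspose_mul, Matrix.conjTranspose_mul,
    Matrix.conjTranspose_conjTranspose, hZ]
  calc _ = toOp U * (onQubit 0 pauliZ * (((toOp U)ᴴ * toOp U) * onQubit 0 pauliZ)) * (toOp U)ᴴ := by
        simp only [Matrix.mul_assoc]
    _ = 1 := by
        rw [conjTranspose_mul_toOp, Matrix.one_mul, hZ2, Matrix.mul_one, toOp_mul_conjTranspose]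

/-- `Z₁` lies in the complexified Lie algebra, which conjugation by the group preserves. -/
theorem evolvedZ_symplectic (U : SP n) :
    (evolvedZ U)ᵀ * sympForm n = -(sympForm n * evolvedZ U) := by
  have hZ : (onQubit (0 : Fin n) pauliZ)ᵀ * sympForm n = -(sympForm n * onQubit 0 pauliZ) := by
    rw [onQubit_pauliZ, pauliString_transpose_mul_sympForm, sympSign_single_zero (by decide)]
    simp
  have hU : ((toOp U)ᴴ)ᵀ * sympForm n = sympForm n * toOp U := by
    have := congrArg Matrix.conjTranspose (sympForm_mul_transpose_toOp U)
    simp only [Matrix.conjTranspose_mul, sympForm_conjTranspose,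
      Matrix.conjTranspose_conjTranspose, Matrix.mul_neg, Matrix.neg_mul, neg_inj] at this
    exact this
  rw [evolvedZ, Matrix.transpose_mul, Matrix.transpose_mul]
  calc _ = ((toOp U)ᴴ)ᵀ * ((onQubit 0 pauliZ)ᵀ * ((toOp U)ᵀ * sympForm n)) := by
        simp only [Matrix.mul_assoc]
    _ = ((toOp U)ᴴ)ᵀ * (((onQubit 0 pauliZ)ᵀ * sympForm n) * (toOp U)ᴴ) := by
        rw [sympForm_mul_toOp, Matrix.mul_assoc]
    _ = -((((toOp U)ᴴ)ᵀ * sympForm n) * (onQubit 0 pauliZ * (toOp U)ᴴ)) := by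
        rw [hZ, Matrix.neg_mul, Matrix.mul_neg]
        simp only [Matrix.mul_assoc]
    _ = _ := by
        rw [hU]
        simp only [Matrix.mul_assoc]

/-- Parseval in the Pauli basis, for the unitary `U Z₁ U†`. -/
theorem sum_norm_pauliCoeff_sq (U : SP n) : ∑ p, ‖pauliCoeff p U‖ ^ 2 = 1 := by
  have h : star ((pauliBasis n)ᴴ *ᵥ vecOp (evolvedZ U * sympForm n)) ⬝ᵥ
      ((pauliBasis n)ᴴ *ᵥ vecOp (evolvedZ U * sympForm n)) = 1 := by
    rw [Matrix.star_mulVec, ← Matrix.dotProduct_mulVec, Matrix.mulVec_mulVec,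
      Matrix.conjTranspose_conjTranspose, pauliBasis_mul_conjTranspose, Matrix.one_mulVec,
      star_vecOp_mul_sympForm, evolvedZ_conjTranspose_mul_self, Matrix.trace_one]
    simp
  rw [pauliBasis_mulVec_evolved, dotProduct] at h
  rw [← Complex.ofReal_inj, Complex.ofReal_one, ← h, Complex.ofReal_sum]
  refine Finset.sum_congr rfl fun p _ => ?_
  rw [Pi.star_apply, RCLike.star_def, mul_comm, Complex.mul_conj, Complex.normSq_eq_norm_sq]

theorem continuous_toOp : Continuous (toOp : SP n → QOp n) :=
  continuous_subtype_val.comp continuous_subtype_val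

theorem continuous_pauliCoeff (p : Fin n → Fin 4) :
    Continuous (pauliCoeff p : SP n → ℂ) := by
  refine Continuous.div_const (Continuous.matrix_trace (continuous_const.matrix_mul ?_)) _
  exact (continuous_toOp.matrix_mul continuous_const).matrix_mul
    continuous_toOp.matrix_conjTranspose

theorem integrable_of_continuous {F : Type*} [NormedAddCommGroup F] (E : Measure (SP n))
    [IsFiniteMeasure E] {f : SP n → F} (hf : Continuous f) : Integrable f E :=
  hf.integrable_of_hasCompactSupport (HasCompactSupport.of_compactSpace f)

/-- The expected weight of the Pauli string `p` in `U Z₁ U†`. -/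
def pauliWeight (E : Measure (SP n)) (p : Fin n → Fin 4) : ℝ :=
  ∫ U, ‖pauliCoeff p U‖ ^ 2 ∂E

theorem integrable_norm_pauliCoeff_sq (E : Measure (SP n)) [IsFiniteMeasure E]
    (p : Fin n → Fin 4) : Integrable (fun U => ‖pauliCoeff p U‖ ^ 2) E :=
  integrable_of_continuous E ((continuous_pauliCoeff p).norm.pow 2)

theorem sum_pauliWeight (E : Measure (SP n)) [IsProbabilityMeasure E] :
    ∑ p, pauliWeight E p = 1 := by
  simp only [pauliWeight]
  rw [← integral_finsetSum _ fun p _ => integrable_norm_pauliCoeff_sq E p]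
  simp [sum_norm_pauliCoeff_sq]

theorem pauliWeight_eq_zero_of_supportedOn {E : Measure (SP n)} {S : Finset (Fin n)}
    (hS : ∀ᵐ U ∂E, SupportedOn S (toOp U * onQubit 0 pauliZ * (toOp U)ᴴ)) {p : Fin n → Fin 4}
    {j : Fin n} (hj : j ∉ S) (hp : p j ≠ 0) : pauliWeight E p = 0 := by
  refine integral_eq_zero_of_ae ?_
  filter_upwards [hS] with U hU
  have : (pauliString p * evolvedZ U).trace = 0 := trace_pauliString_mul_eq_zero hU hj hp
  simp [pauliCoeff, this]

instance : IsProbabilityMeasure (haarSP n) :=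
  ⟨by simpa [haarSP] using
    Measure.haarMeasure_self (K₀ := (⊤ : TopologicalSpace.PositiveCompacts (SP n)))⟩

instance : (haarSP n).IsMulLeftInvariant := by
  unfold haarSP
  infer_instance

theorem pauliWeight_haarSP_of_neg {p : Fin n → Fin 4} (hp : sympSign p = -1) :
    pauliWeight (haarSP n) p = 0 := by
  have : ∀ U, pauliCoeff p U = 0 := fun U => by
    rw [pauliCoeff, trace_pauliString_mul_conj_eq_zero hp (evolvedZ_symplectic U), zero_div]
  simp [pauliWeight, this]

/-- If `V` conjugates `Z₁` to the string `p`, the substitution `U ↦ V * U` matches the two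
integrals. -/
theorem pauliWeight_haarSP_of_pos {p : Fin n → Fin 4} (hp : sympSign p = 1) :
    pauliWeight (haarSP n) p = pauliWeight (haarSP n) (Pi.single 0 3) := by
  obtain ⟨V, hV⟩ := exists_conj_pauliString hp
  rw [pauliWeight, ← integral_mul_left_eq_self _ V, pauliWeight]
  congr 1
  ext1 U
  have : pauliCoeff p (V * U) = pauliCoeff (Pi.single 0 3) U := by
    rw [pauliCoeff, pauliCoeff, ← hV]
    congr 1
    have : evolvedZ (V * U) = toOp V * evolvedZ U * (toOp V)ᴴ := by
      simp only [evolvedZ, toOp_mul, Matrix.conjTranspose_mul, Matrix.mul_assoc]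
    rw [this]
    calc _ = (toOp V * (pauliString (Pi.single 0 3) * (((toOp V)ᴴ * toOp V) * evolvedZ U)) *
          (toOp V)ᴴ).trace := by simp only [Matrix.mul_assoc]
      _ = _ := by
          rw [Matrix.trace_mul_comm, conjTranspose_mul_toOp, Matrix.one_mul, ← Matrix.mul_assoc,
            conjTranspose_mul_toOp, Matrix.one_mul]
  rw [this]

theorem pauliWeight_haarSP (p : Fin n → Fin 4) :
    pauliWeight (haarSP n) p =
      pauliWeight (haarSP n) (Pi.single 0 3) / 2 * (1 + (sympSign p : ℝ)) := by
  rcases sympSign_eq p with h | h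
  · rw [pauliWeight_haarSP_of_pos h, h]
    push_cast
    ring
  · rw [pauliWeight_haarSP_of_neg h, h]
    simp

/-- The sum factorizes over qubits. Every qubit of `S` has three signs `1` and one `-1`; off `S`
only the identity remains, with sign `-1` at qubit `0`. -/
theorem sum_sympSign (S : Finset (Fin n)) :
    ∑ p ∈ stringsOn S, sympSign p = ∏ i, if i ∈ S then 2 else if i = 0 then -1 else 1 := by
  simp only [sympSign, stringsOn]
  rw [← Finset.prod_univ_sum (fun i => if i ∈ S then Finset.univ else {0})
    (fun (i : Fin n) (a : Fin 4) => if i = 0 then (if a = 0 then (-1 : ℤ) else 1) else pauliSymm a)]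
  refine Finset.prod_congr rfl fun i _ => ?_
  split_ifs <;> rfl

theorem sum_sympSign_le (S : Finset (Fin n)) :
    ∑ p ∈ stringsOn S, sympSign p ≤ 2 ^ S.card := by
  rw [sum_sympSign]
  refine (le_abs_self _).trans ?_
  rw [Finset.abs_prod]
  have : ∀ i, |if i ∈ S then (2 : ℤ) else if i = 0 then -1 else 1| = if i ∈ S then 2 else 1 :=
    fun i => by split_ifs <;> simp
  simp [this]

theorem sum_pauliWeight_haarSP (S : Finset (Fin n)) :
    ∑ p ∈ stringsOn S, pauliWeight (haarSP n) p =
      pauliWeight (haarSP n) (Pi.single 0 3) / 2 *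
        (((2 : ℝ) ^ S.card) ^ 2 + ((∑ p ∈ stringsOn S, sympSign p : ℤ) : ℝ)) := by
  rw [Finset.sum_congr rfl fun p _ => pauliWeight_haarSP p, ← Finset.mul_sum,
    Finset.sum_add_distrib, Finset.sum_const, card_stringsOn, Int.cast_sum, nsmul_one]
  have : ((2 : ℝ) ^ S.card) ^ 2 = 4 ^ S.card := by rw [← pow_mul, mul_comm, pow_mul]; norm_num
  rw [this]
  push_cast
  rfl

theorem sum_pauliWeight_haarSP_le (S : Finset (Fin n)) :
    ∑ p ∈ stringsOn S, pauliWeight (haarSP n) p ≤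
      (((2 : ℝ) ^ S.card) ^ 2 + (2 : ℝ) ^ S.card) / ((2 : ℝ) ^ n * ((2 : ℝ) ^ n + 1)) := by
  set w := pauliWeight (haarSP n) (Pi.single 0 3)
  -- Total probability `1`, the case of all qubits, determines the common weight `w`.
  have huniv : w / 2 * ((2 : ℝ) ^ n * ((2 : ℝ) ^ n + 1)) = 1 := by
    have h := sum_pauliWeight_haarSP (n := n) Finset.univ
    have hu : stringsOn (Finset.univ : Finset (Fin n)) = Finset.univ := by
      ext p; simp [mem_stringsOn]
    rw [sum_sympSign, hu, sum_pauliWeight] at h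
    simp only [Finset.mem_univ, if_true, Finset.prod_const, Finset.card_univ,
      Fintype.card_fin] at h
    push_cast at h
    rw [mul_add, mul_one, ← sq]
    exact h.symm
  have hd : (0 : ℝ) < (2 : ℝ) ^ n * ((2 : ℝ) ^ n + 1) := by positivity
  have hw0 : 0 ≤ w / 2 := by
    by_contra! hneg
    nlinarith
  have hs : ((∑ p ∈ stringsOn S, sympSign p : ℤ) : ℝ) ≤ (2 : ℝ) ^ S.card := by
    exact_mod_cast sum_sympSign_le S
  rw [sum_pauliWeight_haarSP, le_div_iff₀ hd]
  calc _ ≤ w / 2 * (((2 : ℝ) ^ S.card) ^ 2 + (2 : ℝ) ^ S.card) *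
        ((2 : ℝ) ^ n * ((2 : ℝ) ^ n + 1)) := by gcongr
    _ = (w / 2 * ((2 : ℝ) ^ n * ((2 : ℝ) ^ n + 1))) *
        (((2 : ℝ) ^ S.card) ^ 2 + (2 : ℝ) ^ S.card) := by ring
    _ = _ := by rw [huniv, one_mul]

end Weights

/-! ### Measuring the second moment -/

section Moments

variable {n : ℕ} [NeZero n]

theorem mul_integral_mul_apply {κ ι : Type*} [Fintype κ] (E : Measure (SP n)) [IsFiniteMeasure E]
    {G : SP n → Matrix κ κ ℂ} (hG : Continuous G) (A : Matrix ι κ ℂ) (B : Matrix κ ι ℂ)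
    (p q : ι) :
    (A * (Matrix.of fun x y => ∫ U, G U x y ∂E) * B) p q = ∫ U, (A * G U * B) p q ∂E := by
  simp only [Matrix.mul_apply, Matrix.of_apply, Finset.sum_mul]
  have hi : ∀ x y, Integrable (fun U => A p x * G U x y * B y q) E := fun x y =>
    ((integrable_of_continuous E (hG.matrix_elem x y)).const_mul _).mul_const _
  rw [integral_finsetSum _ fun y _ => integrable_finsetSum _ fun x _ => hi x y]
  refine Finset.sum_congr rfl fun y _ => ?_
  rw [integral_finsetSum _ fun x _ => hi x y]
  refine Finset.sum_congr rfl fun x _ => ?_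
  rw [integral_mul_const, integral_const_mul]

/-- The pure state obtained by vectorizing `Z₁ Ω`. -/
def probeState (n : ℕ) [NeZero n] : Matrix (Fin 2 → QBasis n) (Fin 2 → QBasis n) ℂ :=
  vecMulVec (vecOp (onQubit 0 pauliZ * sympForm n)) (star (vecOp (onQubit 0 pauliZ * sympForm n)))

theorem isState_probeState : IsState (probeState n) := by
  refine ⟨Matrix.posSemidef_vecMulVec_self_star _, ?_⟩
  rw [probeState, Matrix.trace_vecMulVec, dotProduct_comm, star_vecOp_mul_sympForm,
    onQubit_pauliZ, pauliString_conjTranspose, pauliString_mul_self, Matrix.trace_one]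
  simp

theorem continuous_tensorPow_conj (X : Matrix (Fin 2 → QBasis n) (Fin 2 → QBasis n) ℂ) :
    Continuous fun U : SP n => tensorPow 2 (toOp U) * X * (tensorPow 2 (toOp U))ᴴ := by
  have h : Continuous fun U : SP n => tensorPow 2 (toOp U) :=
    continuous_matrix fun x y => by
      simp only [tensorPow, Matrix.of_apply]
      exact continuous_finsetProd _ fun i _ => continuous_toOp.matrix_elem (x i) (y i)
  exact (h.matrix_mul continuous_const).matrix_mul h.matrix_conjTranspose

/-- For each `U` the output is the pure state `|U Z₁ U† Ω⟩⟩`, whose coordinates in the Pauli basis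
are the `pauliCoeff p U`. -/
theorem re_momentChannel_probeState (E : Measure (SP n)) [IsFiniteMeasure E]
    (p : Fin n → Fin 4) :
    (((pauliBasis n)ᴴ * momentChannel 2 E (probeState n) * pauliBasis n) p p).re =
      pauliWeight E p := by
  have hpt : ∀ U : SP n, ((pauliBasis n)ᴴ * (tensorPow 2 (toOp U) * probeState n *
      (tensorPow 2 (toOp U))ᴴ) * pauliBasis n) p p = ((‖pauliCoeff p U‖ ^ 2 : ℝ) : ℂ) := by
    intro U
    have h1 : tensorPow 2 (toOp U) * probeState n * (tensorPow 2 (toOp U))ᴴ =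
        vecMulVec (vecOp (evolvedZ U * sympForm n)) (star (vecOp (evolvedZ U * sympForm n))) := by
      rw [probeState, Matrix.mul_vecMulVec, Matrix.vecMulVec_mul, ← Matrix.star_mulVec,
        tensorPow_mulVec_evolved]
    have h2 : star (vecOp (evolvedZ U * sympForm n)) ᵥ* pauliBasis n =
        star ((pauliBasis n)ᴴ *ᵥ vecOp (evolvedZ U * sympForm n)) := by
      rw [Matrix.star_mulVec, Matrix.conjTranspose_conjTranspose]
    rw [h1, Matrix.mul_vecMulVec, Matrix.vecMulVec_mul, h2, pauliBasis_mulVec_evolved,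
      Matrix.vecMulVec_apply, Pi.star_apply, RCLike.star_def, Complex.mul_conj,
      Complex.normSq_eq_norm_sq]
  rw [momentChannel, mul_integral_mul_apply E (continuous_tensorPow_conj _)]
  simp only [hpt]
  rw [integral_complex_ofReal, Complex.ofReal_re, pauliWeight]

theorem le_diamondDist_haarSP (E : Measure (SP n)) [IsProbabilityMeasure E] {S : Finset (Fin n)}
    (hS : ∀ᵐ U ∂E, SupportedOn S (toOp U * onQubit 0 pauliZ * (toOp U)ᴴ)) :
    ENNReal.ofReal (2 * (1 - (((2 : ℝ) ^ S.card) ^ 2 + (2 : ℝ) ^ S.card) /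
        ((2 : ℝ) ^ n * ((2 : ℝ) ^ n + 1)))) ≤
      diamondDist (momentChannel 2 E) (momentChannel 2 (haarSP n)) := by
  -- The signed sum is `1` for `E` and `2 h - 1` for Haar, with `h` the Haar probability of a string
  -- on `S`.
  set c : (Fin n → Fin 4) → ℝ := fun p => if p ∈ stringsOn S then 1 else -1 with hc
  refine le_trans (ENNReal.ofReal_le_ofReal ?_) (le_diamondDist (momentChannel 2 E)
    (momentChannel 2 (haarSP n)) isState_probeState pauliBasis_mul_conjTranspose
    conjTranspose_mul_pauliBasis (c := c) fun p => by simp only [hc]; split_ifs <;> norm_num)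
  simp only [Matrix.mul_sub, Matrix.sub_mul, Matrix.sub_apply, Complex.sub_re,
    re_momentChannel_probeState, mul_sub, Finset.sum_sub_distrib]
  have hE : ∑ p, c p * pauliWeight E p = 1 := by
    rw [← sum_pauliWeight E]
    refine Finset.sum_congr rfl fun p _ => ?_
    by_cases hp : p ∈ stringsOn S
    · simp [hc, hp]
    · have hp' := hp
      rw [mem_stringsOn] at hp'
      push Not at hp'
      obtain ⟨j, hj, hpj⟩ := hp'
      rw [pauliWeight_eq_zero_of_supportedOn hS hj hpj, mul_zero]
  have hH : ∑ p, c p * pauliWeight (haarSP n) p =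
      2 * ∑ p ∈ stringsOn S, pauliWeight (haarSP n) p - 1 := by
    rw [← sum_pauliWeight (haarSP n), ← Finset.univ_inter (stringsOn S), ← Finset.sum_ite_mem,
      Finset.mul_sum, ← Finset.sum_sub_distrib]
    refine Finset.sum_congr rfl fun p _ => ?_
    simp only [hc]
    split_ifs <;> ring
  rw [hE, hH]
  linarith [sum_pauliWeight_haarSP_le S]

end Moments

/-! ### Lower bound on the depth -/

theorem card_filter_le_eq_min (n L : ℕ) :
    (Finset.univ.filter fun i : Fin n => (i : ℕ) ≤ L).card = min (L + 1) n := by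
  simp only [← Nat.lt_succ_iff]
  rw [Fin.card_filter_val_lt, min_comm]

end

theorem corollary3 (n : ℕ) [NeZero n] (L : ℕ) (E : Measure (SP n)) [IsProbabilityMeasure E]
    (hE : ∀ᵐ U ∂E, U ∈ circuits n L) :
    -- the bound in terms of any set `S` of qubits containing the supports of all `U Z₁ U†`,
    -- with `d_L = 2 ^ #S` and `d = 2 ^ n`
    (∀ S : Finset (Fin n),
      (∀ᵐ U ∂E, SupportedOn S (toOp U * onQubit 0 pauliZ * (toOp U)ᴴ)) →
      ENNReal.ofReal (2 * (1 - (((2 : ℝ) ^ S.card) ^ 2 + (2 : ℝ) ^ S.card) /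
          ((2 : ℝ) ^ n * ((2 : ℝ) ^ n + 1)))) ≤
        diamondDist (momentChannel 2 E) (momentChannel 2 (haarSP n))) ∧
    -- the first `min (L + 1) n` qubits are such a set
    (∀ᵐ U ∂E, SupportedOn (Finset.univ.filter fun i : Fin n => (i : ℕ) ≤ L)
        (toOp U * onQubit 0 pauliZ * (toOp U)ᴴ)) ∧
    -- hence the bound with `d_L = 2 ^ min (L + 1) n`
    ENNReal.ofReal (2 * (1 - (((2 : ℝ) ^ min (L + 1) n) ^ 2 + (2 : ℝ) ^ min (L + 1) n) /
        ((2 : ℝ) ^ n * ((2 : ℝ) ^ n + 1)))) ≤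
      diamondDist (momentChannel 2 E) (momentChannel 2 (haarSP n)) ∧
    -- hence an approximate 2-design has depth at least `n - 1`
    (∀ ε : ℝ, ε < 3 / 2 - 1 / (2 * ((2 : ℝ) ^ n + 1)) → IsApproxDesign 2 ε E → n - 1 ≤ L) := by
  have hcone : ∀ᵐ U ∂E, SupportedOn (Finset.univ.filter fun i : Fin n => (i : ℕ) ≤ L)
      (toOp U * onQubit 0 pauliZ * (toOp U)ᴴ) := by
    filter_upwards [hE] with U hU using supportedOn_conj_circuit hU pauliZ
  have hbound := le_diamondDist_haarSP E hcone
  rw [card_filter_le_eq_min] at hbound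
  refine ⟨fun S hS => le_diamondDist_haarSP E hS, hcone, hbound, fun ε hε hdes => ?_⟩
  by_contra! hL
  have hle := hbound.trans hdes
  rw [min_eq_left (by omega)] at hle
  have hpow : (2 : ℝ) ^ (L + 1) ≤ 2 ^ n / 2 := by
    rw [le_div_iff₀ two_pos, ← pow_succ]
    exact pow_le_pow_right₀ one_le_two (by omega)
  set d : ℝ := 2 ^ n with hd
  set a : ℝ := 2 ^ (L + 1) with ha
  have hd0 : 0 < d := by positivity
  have ha0 : 0 < a := by positivity
  -- The extreme case `a = d / 2` gives `(d + 2) / (4 (d + 1))`, the source of the threshold on `ε`.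
  have hfrac : (a ^ 2 + a) / (d * (d + 1)) ≤ 1 / 4 + 1 / (4 * (d + 1)) := by
    have : 1 / 4 + 1 / (4 * (d + 1)) = ((d / 2) ^ 2 + d / 2) / (d * (d + 1)) := by
      field_simp
      ring
    rw [this]
    gcongr
  have hfour : 1 / (4 * (d + 1)) = 1 / (2 * (d + 1)) / 2 := by
    field_simp
    norm_num
  have hlt : ε < 2 * (1 - (a ^ 2 + a) / (d * (d + 1))) := by
    rw [hfour] at hfrac
    linarith
  -- `ENNReal.ofReal` truncates at zero, so the strict comparison needs a positive lower bound; `ε`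
  -- itself may be negative.
  have hsmall : 1 / (2 * (d + 1)) ≤ 1 / 2 := by
    rw [div_le_div_iff₀ (by positivity) two_pos]
    linarith
  have hpos : 0 < 2 * (1 - (a ^ 2 + a) / (d * (d + 1))) := by
    rw [hfour] at hfrac
    linarith
  exact absurd hle (not_le.2 ((ENNReal.ofReal_lt_ofReal_iff hpos).2 hlt))
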